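/- Let $\kappa$ be a regular cardinal. Let $\mathcal{C}$ and $\mathcal{E}$ be categories with colimits of small $\kappa$-filtered diagrams, let $\mathcal{D}$ be a replete full subcategory of $\mathcal{E}$ that is closed in $\mathcal{E}$ under colimits of small $\kappa$-filtered diagrams, and let $F : \mathcal{C} \to \mathcal{E}$ be a functor that preserves colimits of small $\kappa$-filtered diagrams. Let $\mathcal{B}$ be the preimage of $\mathcal{D}$ under $F$, i.e. the full subcategory of $\mathcal{C}$ spanned by the objects $C$ such that $FC$ is in $\mathcal{D}$. Then $\mathcal{B}$, with its inclusion into $\mathcal{C}$ and the restriction $\mathcal{B} \to \mathcal{D}$ of $F$, is the strict pullback of $F : \mathcal{C} \to \mathcal{E}$ and $\mathcal{D} \hookrightarrow \mathcal{E}$, and: (i) $\mathcal{B}$ is a replete and full subcategory of $\mathcal{C}$ and is closed in $\mathcal{C}$ under colimits of small $\kappa$-filtered diagrams. (ii) For every regular cardinal $\lambda > \kappa$, if $F : \mathcal{C} \to \mathcal{E}$ and the inclusion $\mathcal{D} \hookrightarrow \mathcal{E}$ are strongly $\lambda$-accessible functors, then $\mathcal{B}$ is a $\lambda$-accessible subcategory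 of $\mathcal{C}$, and moreover the inclusion $\mathcal{B} \hookrightarrow \mathcal{C}$ is a strongly $\lambda$-accessible functor. Here an object $A$ of a category is $\lambda$-presentable if $\mathrm{Hom}(A, -)$ preserves colimits of small $\lambda$-filtered diagrams. A $\lambda$-accessible category is a locally small category that has colimits of small $\lambda$-filtered diagrams and in which, for some set $\mathcal{G}$ of $\lambda$-presentable objects, every object is the colimit of a small $\lambda$-filtered diagram with vertices in $\mathcal{G}$. A strongly $\lambda$-accessible functor is a functor between $\lambda$-accessible categories that preserves colimits of small $\lambda$-filtered diagrams and sends $\lambda$-presentable objects to $\lambda$-presentable objects. A (full) $\lambda$-accessible subcategory of a $\lambda$-accessible category is a (full) subcategory that is a $\lambda$-accessible category and whose inclusion preserves colimits of small $\lambda$-filtered diagrams. -/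

import Mathlib

open CategoryTheory CategoryTheory.Limits

/-- The square of functors with sides `p`, `q`, `F`, `G` commutes on the nose and has the
strict universal property of a pullback, tested against categories in the universes `s`, `t`. -/
def IsStrictPullback.{s, t, v₁, v₂, v₃, v₄, u₁, u₂, u₃, u₄}
    {B : Type u₁} [Category.{v₁} B] {C : Type u₂} [Category.{v₂} C]
    {D : Type u₃} [Category.{v₃} D] {E : Type u₄} [Category.{v₄} E]
    (p : B ⥤ C) (q : B ⥤ D) (F : C ⥤ E) (G : D ⥤ E) : Prop :=
  p ⋙ F = q ⋙ G ∧
    ∀ (X : Type t) [Category.{s} X] (H : X ⥤ C) (K : X ⥤ D), H ⋙ F = K ⋙ G →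
      ∃! L : X ⥤ B, L ⋙ p = H ∧ L ⋙ q = K

/-- A strongly `κ`-accessible functor: the source and the target are `κ`-accessible categories,
and the functor preserves colimits of small `κ`-filtered diagrams and `κ`-presentable objects. -/
structure IsStronglyAccessibleFunctor.{w, v₁, v₂, u₁, u₂}
    {C : Type u₁} [Category.{v₁} C] {D : Type u₂} [Category.{v₂} D]
    (F : C ⥤ D) (κ : Cardinal.{w}) [Fact κ.IsRegular] : Prop where
  source : IsCardinalAccessibleCategory C κ
  target : IsCardinalAccessibleCategory D κ
  preserves_colimits : F.IsCardinalAccessible κ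
  preserves_presentable : ∀ X : C, IsCardinalPresentable X κ → IsCardinalPresentable (F.obj X) κ

/-- The full subcategory of `C` spanned by the objects satisfying `P` is a `κ`-accessible
subcategory of the `κ`-accessible category `C`: it is a `κ`-accessible category, and the
inclusion into `C` is a `κ`-accessible functor. -/
structure IsAccessibleFullSubcategory.{w, v, u} {C : Type u} [Category.{v} C]
    (P : ObjectProperty C) (κ : Cardinal.{w}) [Fact κ.IsRegular] : Prop where
  ambient : IsCardinalAccessibleCategory C κ
  subcategory : IsCardinalAccessibleCategory P.FullSubcategory κ
  inclusion : P.ι.IsCardinalAccessible κ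

/-- The full subcategory of `C` spanned by the objects satisfying `P` is closed in `C` under
colimits of small `κ`-filtered diagrams. -/
def IsClosedUnderFilteredColimits.{w, v, u} {C : Type u} [Category.{v} C]
    (P : ObjectProperty C) (κ : Cardinal.{w}) [Fact κ.IsRegular] : Prop :=
  ∀ (J : Type w) [SmallCategory J] [IsCardinalFiltered J κ], P.IsClosedUnderColimitsOfShape J

universe w s t v₁ v₂ u₁ u₂

universe v₃ u₃

/-! The pullback property and closure under `κ`-filtered colimits are formal. For (ii), with `μ` as
the larger cardinal, the point is that a map `A ⟶ X` from a `μ`-presentable `A`, where `F X` lies in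
`D`, factors through a `μ`-presentable `A'` with `F A'` in `D`. Write `X`, and `F X` inside `D`, as
`μ`-directed colimits of `μ`-presentables. Strong accessibility makes both diagrams over `F X`
consist of `μ`-presentables of `E`, so they contain interleaved chains of length `κ`
(`exists_interleaved_chains`), lying beyond a stage through which `A ⟶ X` factors. Let `A'` be the
colimit in `C` of the first chain. It is `μ`-presentable because `κ < μ`, and `F A'` is also the
colimit of the second chain (`exists_colimitPresentation_of_interleaving`), hence lies in `D`. The
factorization makes the `μ`-presentables of the preimage cofinal among those over `X`, so they
generate it (`isStronglyAccessibleFunctor_ι`). -/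

namespace CategoryTheory

/-! ### The preimage as a strict pullback -/

section StrictPullback

variable {C : Type u₁} [Category.{v₁} C] {E : Type u₂} [Category.{v₂} E]

lemma ObjectProperty.functor_ext_of_comp_ι {P : ObjectProperty C} {X : Type u₃} [Category.{v₃} X]
    {H K : X ⥤ P.FullSubcategory} (h : H ⋙ P.ι = K ⋙ P.ι) : H = K := by
  have hobj (x : X) : H.obj x = K.obj x :=
    ObjectProperty.FullSubcategory.ext (Functor.congr_obj h x)
  refine Functor.ext hobj (fun x y f ↦ P.ι.map_injective ?_)
  have := Functor.congr_hom h f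
  rw [Functor.comp_map] at this
  simpa [eqToHom_map] using this

/-- Functors into a full subcategory are determined by their composite with the inclusion, so `H`
alone determines `L`, and agreement with `K` can be tested in `E`. -/
lemma isStrictPullback_inverseImage (D : ObjectProperty E) (F : C ⥤ E) :
    IsStrictPullback.{s, t} (D.inverseImage F).ι
      (D.lift ((D.inverseImage F).ι ⋙ F) (fun X ↦ X.property)) F D.ι := by
  refine ⟨rfl, fun X _ H K h ↦ ?_⟩
  have hH (x : X) : D.inverseImage F (H.obj x) := by
    have := (K.obj x).property
    rwa [show (K.obj x).obj = F.obj (H.obj x) from (Functor.congr_obj h x).symm] at this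
  refine ⟨(D.inverseImage F).lift H hH, ⟨rfl, ObjectProperty.functor_ext_of_comp_ι h⟩, ?_⟩
  rintro L ⟨hL, -⟩
  exact ObjectProperty.functor_ext_of_comp_ι hL

end StrictPullback

/-! ### Colimits of interleaved diagrams -/

section Interleaving

variable {E : Type u₁} [Category.{v₁} E]

/-- If a natural transformation `f : U ⟶ V` between functors from a filtered category can be
interleaved with maps from objects of `V` to later objects of `U`, then `U` and `V` have the same
colimit. -/
lemma Limits.exists_colimitPresentation_of_interleaving {I : Type u₂} [Category.{v₂} I] [IsFiltered I]
    {U V : I ⥤ E} (f : U ⟶ V)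
    (hf : ∀ i, ∃ (i' : I) (u : i ⟶ i') (g : V.obj i ⟶ U.obj i'),
      f.app i ≫ g = U.map u ∧ g ≫ f.app i' = V.map u)
    {c : Cocone U} (hc : IsColimit c) :
    ∃ p : ColimitPresentation I c.pt, p.diag = V := by
  choose n u g hg₁ hg₂ using hf
  let c' : Cocone V :=
    { pt := c.pt
      ι :=
        { app i := g i ≫ c.ι.app (n i)
          naturality i j v := by
            obtain ⟨m, a, b, hab⟩ := IsFiltered.span (u i) (v ≫ u j)
            -- The maps `g` need not be natural. The two composites agree after `f.app m`, and
            -- following with `g m` turns this into equality at a later stage of `U`, which suffices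
            -- in the colimit.
            have key : (g i ≫ U.map a) ≫ f.app m = (V.map v ≫ g j ≫ U.map b) ≫ f.app m := by
              simp only [Category.assoc, NatTrans.naturality]
              rw [reassoc_of% (hg₂ i), reassoc_of% (hg₂ j), ← V.map_comp, ← V.map_comp,
                ← V.map_comp, hab, Category.assoc]
            have := congr($key ≫ g m)
            simp only [Category.assoc, hg₁] at this
            have := congr($this ≫ c.ι.app (n m))
            simpa using this.symm } }
  refine ⟨{ diag := V, ι := c'.ι, isColimit := ?_ }, rfl⟩
  exact
    { desc s := hc.desc ((Cocone.precompose f).obj s)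
      fac s i := by
        change (g i ≫ c.ι.app (n i)) ≫ _ = _
        rw [Category.assoc, hc.fac]
        change g i ≫ f.app (n i) ≫ s.ι.app (n i) = _
        rw [reassoc_of% (hg₂ i), s.w]
      uniq s m hm := by
        refine hc.hom_ext (fun i ↦ ?_)
        rw [hc.fac]
        change _ = f.app i ≫ s.ι.app i
        rw [← hm i]
        change _ = f.app i ≫ (g i ≫ c.ι.app (n i)) ≫ m
        rw [Category.assoc, reassoc_of% (hg₁ i), c.w_assoc] }

end Interleaving

/-- If families of cardinality `< μ` are bounded for a relation `R`, there are `R`-increasing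
chains indexed by any regular cardinal `κ < μ`. -/
lemma exists_chain_of_bounded_families {κ μ : Cardinal.{w}} (hκμ : κ < μ)
    {T : Type u₁} (R : T → T → Prop)
    (hR : ∀ (ι : Type w) (s : ι → T), HasCardinalLT ι μ → ∃ t, ∀ i, R (s i) t) :
    ∃ t : κ.ord.ToType → T, ∀ i j, i < j → R (t i) (t j) := by
  have hcard (i : κ.ord.ToType) : HasCardinalLT {j // j < i} μ := by
    rw [hasCardinalLT_iff_cardinal_mk_lt]
    exact (Cardinal.mk_subtype_le _).trans_lt (by simpa using hκμ)
  choose b hb using hR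
  -- Well-founded recursion: stage `i` bounds all earlier stages, of which there are fewer than `μ`.
  let t : κ.ord.ToType → T := WellFoundedLT.fix
    (fun i r ↦ b {j // j < i} (fun j ↦ r j.1 j.2) (hcard i))
  have ht (j) : t j = b {i // i < j} (fun i ↦ t i) (hcard j) := WellFoundedLT.fix_eq _ _
  refine ⟨t, fun i j hij ↦ ?_⟩
  rw [ht j]
  exact hb _ (fun i : {i // i < j} ↦ t i) (hcard j) ⟨i, hij⟩

/-! ### Interleaved chains in two directed diagrams with a common colimit -/

section Chain

variable {E : Type u₁} [Category.{v₁} E] {μ : Cardinal.{w}} [Fact μ.IsRegular]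
  {J K : Type w} [PartialOrder J] [PartialOrder K]
  [IsCardinalFiltered J μ] [IsCardinalFiltered K μ]
  {Y : E} (p : ColimitPresentation J Y) (q : ColimitPresentation K Y)

/-- A morphism over the common colimit from an object of one diagram to an object of another. -/
structure Limits.ColimitPresentation.Link where
  src : J
  tgt : K
  hom : p.diag.obj src ⟶ q.diag.obj tgt
  w : hom ≫ q.ι.app tgt = p.ι.app src

variable {p q}

/-- The link `a` precedes `b`: there are compatible transition maps together with a map back from
the target of `a` to the source of `b`. -/
structure Limits.ColimitPresentation.Link.Precedes (a b : Limits.ColimitPresentation.Link p q) : Prop where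
  src_le : a.src ≤ b.src
  tgt_le : a.tgt ≤ b.tgt
  exists_back : ∃ g : q.diag.obj a.tgt ⟶ p.diag.obj b.src,
    a.hom ≫ g = p.diag.map (homOfLE src_le) ∧ g ≫ b.hom = q.diag.map (homOfLE tgt_le)

lemma Limits.ColimitPresentation.Link.Precedes.naturality {a b : Limits.ColimitPresentation.Link p q}
    (h : a.Precedes b) :
    p.diag.map (homOfLE h.src_le) ≫ b.hom = a.hom ≫ q.diag.map (homOfLE h.tgt_le) := by
  obtain ⟨g, hg₁, hg₂⟩ := h.exists_back
  rw [← hg₁, ← hg₂, Category.assoc]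

lemma IsCardinalFiltered.exists_upper_bound {ι : Type w} (hι : HasCardinalLT ι μ) (s : ι → J) :
    ∃ j, ∀ i, s i ≤ j :=
  ⟨IsCardinalFiltered.max s hι, fun i ↦ leOfHom (IsCardinalFiltered.toMax s hι i)⟩

/-- Presentability lifts each target's map to the colimit back into `p`, and a later stage corrects
the triangle. At a common bound the object of `p` maps to `q`, and a second common bound corrects
the other triangles. Bounds exist as there are fewer than `μ` links. -/
lemma Limits.ColimitPresentation.Link.exists_precedes
    (hp : ∀ j, IsCardinalPresentable (p.diag.obj j) μ)
    (hq : ∀ k, IsCardinalPresentable (q.diag.obj k) μ)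
    {ι : Type w} (hι : HasCardinalLT ι μ) (a : ι → Limits.ColimitPresentation.Link p q) (j₀ : J) :
    ∃ b : Limits.ColimitPresentation.Link p q, j₀ ≤ b.src ∧ ∀ i, (a i).Precedes b := by
  have hback (i : ι) : ∃ (j : J) (hj : (a i).src ≤ j) (g : q.diag.obj (a i).tgt ⟶ p.diag.obj j),
      (a i).hom ≫ g = p.diag.map (homOfLE hj) ∧ g ≫ p.ι.app j = q.ι.app (a i).tgt := by
    obtain ⟨j₁, g₁, hg₁⟩ :=
      IsCardinalPresentable.exists_hom_of_isColimit μ p.isColimit (q.ι.app (a i).tgt)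
    change g₁ ≫ p.ι.app j₁ = _ at hg₁
    obtain ⟨j₂, u, v, h⟩ := IsCardinalPresentable.exists_eq_of_isColimit μ p.isColimit
      ((a i).hom ≫ g₁) (𝟙 _) (by
        change ((a i).hom ≫ g₁) ≫ p.ι.app j₁ = 𝟙 _ ≫ p.ι.app _
        rw [Category.assoc, hg₁, (a i).w, Category.id_comp])
    refine ⟨j₂, leOfHom v, g₁ ≫ p.diag.map u, ?_, ?_⟩
    · rw [← Category.assoc, h, Category.id_comp]
      rfl
    · rw [Category.assoc, ← hg₁]
      congr 1
      exact p.cocone.w u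
  choose j hj g hg₁ hg₂ using hback
  obtain ⟨j₁, hj₁⟩ := IsCardinalFiltered.exists_upper_bound hι j
  have := isFiltered_of_isCardinalFiltered J μ
  have := IsFiltered.isDirectedOrder J
  obtain ⟨j', hj₁', hj₀'⟩ := exists_ge_ge j₁ j₀
  obtain ⟨k₁, f₁, hf₁⟩ :=
    IsCardinalPresentable.exists_hom_of_isColimit μ q.isColimit (p.ι.app j')
  change f₁ ≫ q.ι.app k₁ = _ at hf₁
  have hle (i : ι) : j i ≤ j' := (hj₁ i).trans hj₁'
  have heq (i : ι) : ∃ (k : K) (hk : k₁ ≤ k) (hk' : (a i).tgt ≤ k),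
      (g i ≫ p.diag.map (homOfLE (hle i))) ≫ f₁ ≫ q.diag.map (homOfLE hk) =
        q.diag.map (homOfLE hk') := by
    obtain ⟨k, u, v, h⟩ := IsCardinalPresentable.exists_eq_of_isColimit μ q.isColimit
      ((g i ≫ p.diag.map (homOfLE (hle i))) ≫ f₁) (𝟙 (q.diag.obj (a i).tgt)) (by
        change ((g i ≫ p.diag.map (homOfLE (hle i))) ≫ f₁) ≫ q.ι.app k₁ = 𝟙 _ ≫ q.ι.app _
        rw [Category.assoc, hf₁, Category.assoc, Category.id_comp, ← hg₂]
        congr 1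
        exact p.cocone.w _)
    refine ⟨k, leOfHom u, leOfHom v, ?_⟩
    rw [Category.id_comp] at h
    rw [← Category.assoc]
    exact h
  choose k hk hk' hgf using heq
  obtain ⟨k₂, hk₂⟩ := IsCardinalFiltered.exists_upper_bound hι k
  have := isFiltered_of_isCardinalFiltered K μ
  have := IsFiltered.isDirectedOrder K
  obtain ⟨k', hk₁', hk₂'⟩ := exists_ge_ge k₁ k₂
  have hle' (i : ι) : k i ≤ k' := (hk₂ i).trans hk₂'
  refine ⟨⟨j', k', f₁ ≫ q.diag.map (homOfLE hk₁'), ?_⟩, hj₀', fun i ↦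
    ⟨(hj i).trans (hle i), (hk' i).trans (hle' i), g i ≫ p.diag.map (homOfLE (hle i)), ?_, ?_⟩⟩
  · rw [Category.assoc, ← hf₁]
    congr 1
    exact q.cocone.w _
  · have := congr($(hg₁ i) ≫ p.diag.map (homOfLE (hle i)))
    simpa only [Category.assoc, ← p.diag.map_comp, homOfLE_comp] using this
  · have := congr($(hgf i) ≫ q.diag.map (homOfLE (hle' i)))
    simpa only [Category.assoc, ← q.diag.map_comp, homOfLE_comp] using this

/-- Two presentations of the same object as `μ`-directed colimits of `μ`-presentable objects
admit interleaved subchains of any regular length `κ < μ`. -/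
lemma Limits.ColimitPresentation.exists_interleaved_chains
    {κ : Cardinal.{w}} [Fact κ.IsRegular] (hκμ : κ < μ)
    (hp : ∀ j, IsCardinalPresentable (p.diag.obj j) μ)
    (hq : ∀ k, IsCardinalPresentable (q.diag.obj k) μ) (j₀ : J) :
    ∃ (a : κ.ord.ToType ⥤ J) (b : κ.ord.ToType ⥤ K) (f : a ⋙ p.diag ⟶ b ⋙ q.diag),
      (∀ i, j₀ ≤ a.obj i) ∧
      ∀ i, ∃ (i' : κ.ord.ToType) (u : i ⟶ i') (g : (b ⋙ q.diag).obj i ⟶ (a ⋙ p.diag).obj i'),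
        f.app i ≫ g = (a ⋙ p.diag).map u ∧ g ≫ f.app i' = (b ⋙ q.diag).map u := by
  obtain ⟨t, ht⟩ := exists_chain_of_bounded_families hκμ
    (fun (x y : {a : Limits.ColimitPresentation.Link p q // j₀ ≤ a.src}) ↦ x.1.Precedes y.1)
    (fun ι s hι ↦ by
      obtain ⟨b, hb₀, hb⟩ :=
        Limits.ColimitPresentation.Link.exists_precedes hp hq hι (fun i ↦ (s i).1) j₀
      exact ⟨⟨b, hb₀⟩, hb⟩)
  have ha : Monotone (fun i ↦ (t i).1.src) := fun i j hij ↦ by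
    obtain rfl | h := hij.eq_or_lt
    · rfl
    · exact (ht _ _ h).src_le
  have hb : Monotone (fun i ↦ (t i).1.tgt) := fun i j hij ↦ by
    obtain rfl | h := hij.eq_or_lt
    · rfl
    · exact (ht _ _ h).tgt_le
  refine ⟨ha.functor, hb.functor,
    { app i := (t i).1.hom
      naturality i j u := ?_ }, fun i ↦ (t i).2, fun i ↦ ?_⟩
  · obtain rfl | h := (leOfHom u).eq_or_lt
    · obtain rfl : u = 𝟙 _ := Subsingleton.elim _ _
      simp
    · exact (ht _ _ h).naturality
  -- Back maps exist only between strictly increasing indices, so a later index is needed; `κ.ord`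
  -- is a limit ordinal.
  · have : NoMaxOrder κ.ord.ToType :=
      Cardinal.noMaxOrder (Cardinal.IsRegular.aleph0_le Fact.out)
    obtain ⟨i', hi'⟩ := exists_gt i
    obtain ⟨g, hg⟩ := (ht _ _ hi').exists_back
    exact ⟨i', homOfLE hi'.le, g, hg⟩

end Chain

/-! ### Cofinal subcategories of the canonical diagram -/

section Cofinal

variable {C : Type u₁} [Category.{v₁} C] {E : Type u₂} [Category.{v₂} E]

lemma IsCardinalFiltered.of_exists_of_fullyFaithful {μ : Cardinal.{w}} [Fact μ.IsRegular]
    (F : C ⥤ E) [IsCardinalFiltered E μ] [F.Full] [F.Faithful]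
    (h : ∀ d, ∃ c, Nonempty (d ⟶ F.obj c)) : IsCardinalFiltered C μ where
  nonempty_cocone G hA := by
    let c := IsCardinalFiltered.cocone (G ⋙ F) hA
    obtain ⟨x, ⟨f⟩⟩ := h c.pt
    exact ⟨{ pt := x
             ι :=
              { app a := F.preimage (c.ι.app a ≫ f)
                naturality a b u := F.map_injective (by simpa using c.w_assoc u f) } }⟩

/-- In a `μ`-accessible category, if any map from a `μ`-presentable object to `X` factors through
an object of a class `P` of `μ`-presentable objects, then `X` is a small `μ`-filtered colimit of
objects in `P`. -/
lemma IsCardinalAccessibleCategory.exists_colimitsOfShape_of_factorization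
    {μ : Cardinal.{w}} [Fact μ.IsRegular] [IsCardinalAccessibleCategory C μ]
    {P : ObjectProperty C} (hP : P ≤ isCardinalPresentable C μ) (X : C)
    (h : ∀ (A : C) (_ : IsCardinalPresentable A μ) (f : A ⟶ X),
      ∃ (A' : C) (_ : P A') (g : A ⟶ A') (f' : A' ⟶ X), g ≫ f' = f) :
    ∃ (J : Type w) (_ : SmallCategory J) (_ : IsCardinalFiltered J μ), P.colimitsOfShape J X := by
  let G : CostructuredArrow P.ι X ⥤ CostructuredArrow (isCardinalPresentable C μ).ι X :=
    CostructuredArrow.pre (ObjectProperty.ιOfLE hP) (isCardinalPresentable C μ).ι X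
  have hG (d) : ∃ c, Nonempty (d ⟶ G.obj c) := by
    obtain ⟨A', hA', g, f', hf'⟩ := h d.left.obj d.left.property d.hom
    let c : CostructuredArrow P.ι X :=
      CostructuredArrow.mk (Y := (⟨A', hA'⟩ : P.FullSubcategory)) (by exact f')
    let φ : d.left ⟶ (G.obj c).left := ObjectProperty.homMk g
    exact ⟨c, ⟨CostructuredArrow.homMk φ (by simpa [G, c, φ] using hf')⟩⟩
  have : G.Full := inferInstanceAs (CostructuredArrow.pre (ObjectProperty.ιOfLE hP) (isCardinalPresentable C μ).ι X).Full
  have : G.Faithful := inferInstanceAs (CostructuredArrow.pre (ObjectProperty.ιOfLE hP) (isCardinalPresentable C μ).ι X).Faithful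
  have := isFiltered_of_isCardinalFiltered
    (CostructuredArrow (isCardinalPresentable C μ).ι X) μ
  have : IsCardinalFiltered (CostructuredArrow P.ι X) μ := .of_exists_of_fullyFaithful G hG
  have : G.Final := Functor.final_of_exists_of_isFiltered_of_fullyFaithful G hG
  have : ObjectProperty.EssentiallySmall.{w} P := .of_le hP
  -- Finality of `G` restricts the canonical colimit to `P`; a small model then supplies an index
  -- category in `Type w`.
  have : EssentiallySmall.{w} (CostructuredArrow P.ι X) := inferInstance
  let e := equivSmallModel.{w} (CostructuredArrow P.ι X)
  have hc := (Functor.Final.isColimitWhiskerEquiv (F := e.inverse ⋙ G) _).2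
    ((isCardinalPresentable C μ).ι.denseAt X)
  refine ⟨SmallModel.{w} (CostructuredArrow P.ι X), inferInstance, .of_equivalence μ e, ⟨?_⟩⟩
  exact
    { diag := e.inverse ⋙ CostructuredArrow.proj P.ι X ⋙ P.ι
      ι := 
        { app j := (e.inverse.obj j).hom
          naturality _ _ u :=
            (CostructuredArrow.w (e.inverse.map u)).trans (Category.comp_id _).symm }
      isColimit := IsColimit.ofIsoColimit hc (Cocone.ext (Iso.refl _) (fun j ↦
        (Category.comp_id _).trans (Category.id_comp _)))
      prop_diag_obj j := (e.inverse.obj j).left.property }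

end Cofinal

lemma hasCardinalLT_arrow_toType {κ μ : Cardinal.{w}} [Fact μ.IsRegular] (hκμ : κ < μ) :
    HasCardinalLT (Arrow κ.ord.ToType) μ := by
  have h : HasCardinalLT κ.ord.ToType μ := by
    rw [hasCardinalLT_iff_cardinal_mk_lt]
    simpa using hκμ
  refine (hasCardinalLT_prod (Cardinal.IsRegular.aleph0_le Fact.out) h h).of_injective
    (fun f : Arrow κ.ord.ToType ↦ (f.left, f.right)) ?_
  rintro ⟨a, b, f⟩ ⟨a', b', f'⟩ h
  obtain ⟨rfl, rfl⟩ := Prod.mk.inj h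
  obtain rfl : f = f' := Subsingleton.elim _ _
  rfl

/-! ### Accessibility of the preimage -/

section Preimage

variable {C : Type u₁} [Category.{v₁} C] {E : Type u₂} [Category.{v₂} E]
  {κ μ : Cardinal.{w}} [Fact κ.IsRegular] [Fact μ.IsRegular]

lemma ObjectProperty.ColimitOfShape.exists_directed {P : ObjectProperty C} {X : C}
    (h : ∃ (J : Type w) (_ : SmallCategory J) (_ : IsCardinalFiltered J μ),
      P.colimitsOfShape J X) :
    ∃ (J : Type w) (_ : PartialOrder J) (_ : IsCardinalFiltered J μ),
      P.colimitsOfShape J X := by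
  obtain ⟨J, _, _, ⟨p⟩⟩ := h
  -- Over a poset, increasing families of indices are automatically functors, as the chain
  -- construction requires.
  obtain ⟨α, _, _, F, _⟩ := IsCardinalFiltered.exists_cardinal_directed J μ
  exact ⟨α, inferInstance, inferInstance, ⟨{
    toColimitPresentation := p.toColimitPresentation.reindex F
    prop_diag_obj j := p.prop_diag_obj (F.obj j) }⟩⟩

lemma exists_factorization_of_isCardinalPresentable (hκμ : κ < μ)
    [HasCardinalFilteredColimits C κ] [IsCardinalAccessibleCategory C μ]
    (D : ObjectProperty E) [D.IsClosedUnderIsomorphisms]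
    (hD : IsClosedUnderFilteredColimits D κ)
    (F : C ⥤ E) [F.IsCardinalAccessible κ]
    (hF : IsStronglyAccessibleFunctor F μ) (hι : IsStronglyAccessibleFunctor D.ι μ)
    {X : C} (hX : D (F.obj X)) {A : C} [IsCardinalPresentable A μ] (f : A ⟶ X) :
    ∃ (A' : C) (_ : IsCardinalPresentable A' μ) (_ : D (F.obj A')) (g : A ⟶ A') (f' : A' ⟶ X),
      g ≫ f' = f := by
  obtain ⟨J, _, _, ⟨p⟩⟩ := ObjectProperty.ColimitOfShape.exists_directed
    ((isCardinalFilteredGenerator_isCardinalPresentable C μ).exists_colimitsOfShape X)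
  have := hι.source
  obtain ⟨K, _, _, ⟨q⟩⟩ := ObjectProperty.ColimitOfShape.exists_directed
    ((isCardinalFilteredGenerator_isCardinalPresentable D.FullSubcategory μ).exists_colimitsOfShape
      ⟨F.obj X, hX⟩)
  have := hF.preserves_colimits.preservesColimitOfShape J
  have := hι.preserves_colimits.preservesColimitOfShape K
  let p' : ColimitPresentation J (F.obj X) := p.toColimitPresentation.map F
  let q' : ColimitPresentation K (F.obj X) := q.toColimitPresentation.map D.ι
  have hp (j) : IsCardinalPresentable (p.diag.obj j) μ := p.prop_diag_obj j
  have hp' (j) : IsCardinalPresentable (p'.diag.obj j) μ :=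
    hF.preserves_presentable _ (p.prop_diag_obj j)
  have hq' (k) : IsCardinalPresentable (q'.diag.obj k) μ :=
    hι.preserves_presentable _ (q.prop_diag_obj k)
  obtain ⟨j₀, g, hg⟩ := IsCardinalPresentable.exists_hom_of_isColimit μ p.isColimit f
  change g ≫ p.ι.app j₀ = f at hg
  obtain ⟨a, b, φ, ha, hφ⟩ :=
    ColimitPresentation.exists_interleaved_chains (p := p') (q := q') hκμ hp' hq' j₀
  have := HasCardinalFilteredColimits.hasColimitsOfShape C κ κ.ord.ToType
  have := F.preservesColimitsOfShape_of_isCardinalAccessible κ κ.ord.ToType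
  have := isFiltered_of_isCardinalFiltered κ.ord.ToType κ
  have hc := isColimitOfPreserves F (colimit.isColimit (a ⋙ p.diag))
  have := IsFiltered.nonempty (C := κ.ord.ToType)
  have i₀ : κ.ord.ToType := Classical.arbitrary _
  refine ⟨colimit (a ⋙ p.diag), ?_, ?_,
    g ≫ p.diag.map (homOfLE (ha i₀)) ≫ colimit.ι (a ⋙ p.diag) i₀,
    colimit.desc (a ⋙ p.diag) (p.cocone.whisker a), ?_⟩
  · have (i : κ.ord.ToType) : IsCardinalPresentable ((a ⋙ p.diag).obj i) μ := hp _
    exact isCardinalPresentable_of_isColimit _ (colimit.isColimit (a ⋙ p.diag)) μ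
      (hasCardinalLT_arrow_toType hκμ)
  -- `F` preserves the colimit of the chain because `κ.ord.ToType` is `κ`-filtered; interleaving
  -- then presents the same object by a chain in `D`.
  · obtain ⟨r, hr⟩ := exists_colimitPresentation_of_interleaving φ hφ hc
    have := hD κ.ord.ToType
    refine D.prop_of_isColimit r.isColimit (fun i ↦ ?_)
    rw [hr]
    exact (q.diag.obj (b.obj i)).property
  · rw [Category.assoc, Category.assoc, colimit.ι_desc, ← hg]
    congr 1
    exact p.cocone.w _

lemma isClosedUnderFilteredColimits_inverseImage (D : ObjectProperty E)
    (hD : IsClosedUnderFilteredColimits D κ) (F : C ⥤ E) [F.IsCardinalAccessible κ] :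
    IsClosedUnderFilteredColimits (D.inverseImage F) κ := fun J _ _ ↦ by
  have := hD J
  have := F.preservesColimitsOfShape_of_isCardinalAccessible κ J
  infer_instance

/-- `Hom(X, -)` is `G` followed by `Hom(G X, -)`, and both preserve `μ`-filtered colimits. -/
lemma isCardinalPresentable_of_fullyFaithful {B : Type u₃} [Category.{v₁} B] {G : B ⥤ C}
    (hG : G.FullyFaithful) [G.IsCardinalAccessible μ] {X : B}
    [IsCardinalPresentable (G.obj X) μ] : IsCardinalPresentable X μ := by
  have : (coyoneda.obj (.op (G.obj X))).IsCardinalAccessible μ := ‹_›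
  let e : G ⋙ coyoneda.obj (.op (G.obj X)) ≅ coyoneda.obj (.op X) :=
    NatIso.ofComponents (fun Y ↦ hG.homEquiv.symm.toIso) (fun f ↦ by
      ext g
      exact hG.map_injective (by simp [Functor.FullyFaithful.homEquiv]))
  exact Functor.isCardinalAccessible_of_natIso e μ

/-- A full subcategory of a `μ`-accessible category which is closed under `μ`-filtered colimits
and in which maps from `μ`-presentable objects of the ambient category factor through
`μ`-presentable objects of the subcategory is `μ`-accessible, and its inclusion is a strongly
`μ`-accessible functor. -/
lemma isStronglyAccessibleFunctor_ι [IsCardinalAccessibleCategory C μ] (P : ObjectProperty C)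
    [P.IsClosedUnderIsomorphisms]
    (hP : IsClosedUnderFilteredColimits P μ)
    (h : ∀ (X : C) (_ : P X) (A : C) (_ : IsCardinalPresentable A μ) (f : A ⟶ X),
      ∃ (A' : C) (_ : IsCardinalPresentable A' μ) (_ : P A') (g : A ⟶ A') (f' : A' ⟶ X),
        g ≫ f' = f) :
    IsStronglyAccessibleFunctor P.ι μ := by
  have hcolim : HasCardinalFilteredColimits P.FullSubcategory μ := ⟨fun J _ _ ↦ by
    have := hP J
    have := HasCardinalFilteredColimits.hasColimitsOfShape C μ J
    infer_instance⟩
  have hpres : P.ι.IsCardinalAccessible μ := ⟨fun J _ _ ↦ by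
    have := hP J
    have := HasCardinalFilteredColimits.hasColimitsOfShape C μ J
    infer_instance⟩
  let Q : ObjectProperty P.FullSubcategory := (isCardinalPresentable C μ).inverseImage P.ι
  have hQ : Q.IsCardinalFilteredGenerator μ :=
    { le_isCardinalPresentable := fun X (hX : IsCardinalPresentable X.obj μ) ↦ by
        have : IsCardinalPresentable (P.ι.obj X) μ := hX
        exact isCardinalPresentable_of_fullyFaithful P.fullyFaithfulι
      exists_colimitsOfShape X := by
        obtain ⟨J, _, _, ⟨p⟩⟩ :=
          IsCardinalAccessibleCategory.exists_colimitsOfShape_of_factorization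
            (P := isCardinalPresentable C μ ⊓ P) inf_le_left X.obj (fun A _ f ↦ by
              obtain ⟨A', h₁, h₂, g, f', hf⟩ := h X.obj X.property A inferInstance f
              exact ⟨A', ⟨h₁, h₂⟩, g, f', hf⟩)
        refine ⟨J, inferInstance, inferInstance, ⟨{
          diag := P.lift p.diag (fun j ↦ (p.prop_diag_obj j).2)
          ι := { app j := ObjectProperty.homMk (p.ι.app j)
                 naturality _ _ u := P.ι.map_injective (p.ι.naturality u) }
          isColimit := isColimitOfReflects P.ι p.isColimit
          prop_diag_obj j := (p.prop_diag_obj j).1 }⟩⟩ }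
  have : LocallySmall.{w} P.FullSubcategory := inferInstance
  have : ObjectProperty.EssentiallySmall.{w} Q := by
    let R : ObjectProperty C := isCardinalPresentable C μ ⊓ P
    have : ObjectProperty.EssentiallySmall.{w} R := .of_le inf_le_left
    have hQR : Q ≤ (ObjectProperty.ιOfLE (inf_le_right : R ≤ P)).essImage := fun X hX ↦
      ⟨⟨X.obj, hX, X.property⟩, ⟨Iso.refl _⟩⟩
    exact .of_le hQR
  refine ⟨{ toHasCardinalFilteredGenerator := hQ.hasCardinalFilteredGenerator },
    inferInstance, hpres, fun X hX ↦ ?_⟩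
  -- A `μ`-presentable object of the subcategory is a retract of a generator in `Q`, which is
  -- `μ`-presentable in `C`; retracts inherit this.
  have hX' : Q.retractClosure X := by
    rw [← hQ.isPresentable_eq_retractClosure]
    exact hX
  obtain ⟨Y, hY, ⟨r⟩⟩ := hX'
  have : IsCardinalPresentable (P.ι.obj Y) μ := hY
  exact (r.map P.ι).isCardinalPresentable μ

end Preimage

end CategoryTheory

theorem mainTheorem9
    (κ : Cardinal.{w}) [Fact κ.IsRegular]
    {C : Type u₁} [Category.{v₁} C] [HasCardinalFilteredColimits C κ]
    {E : Type u₂} [Category.{v₂} E] [HasCardinalFilteredColimits E κ]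
    -- the replete full subcategory of `E`, given by its objects
    (D : ObjectProperty E) [D.IsClosedUnderIsomorphisms]
    (hD : IsClosedUnderFilteredColimits D κ)
    (F : C ⥤ E) [F.IsCardinalAccessible κ] :
    -- the full subcategory of `C` on the preimage of `D` is the strict pullback
    IsStrictPullback.{s, t} (D.inverseImage F).ι
        (D.lift ((D.inverseImage F).ι ⋙ F) (fun X => X.property)) F D.ι ∧
      -- (i)
      ((D.inverseImage F).IsClosedUnderIsomorphisms ∧
        (D.inverseImage F).ι.Full ∧ (D.inverseImage F).ι.Faithful ∧
        IsClosedUnderFilteredColimits (D.inverseImage F) κ) ∧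
      -- (ii)
      (∀ (μ : Cardinal.{w}) [Fact μ.IsRegular], κ < μ →
        IsStronglyAccessibleFunctor F μ → IsStronglyAccessibleFunctor D.ι μ →
          IsAccessibleFullSubcategory (D.inverseImage F) μ ∧
            IsStronglyAccessibleFunctor (D.inverseImage F).ι μ) := by
  have hB : IsClosedUnderFilteredColimits (D.inverseImage F) κ :=
    isClosedUnderFilteredColimits_inverseImage D hD F
  refine ⟨isStrictPullback_inverseImage D F,
    ⟨inferInstance, inferInstance, inferInstance, hB⟩, fun μ _ hκμ hF hι ↦ ?_⟩
  have := hF.source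
  have hBμ : IsClosedUnderFilteredColimits (D.inverseImage F) μ := fun J _ _ ↦
    have := IsCardinalFiltered.of_le J hκμ.le
    hB J
  have h : IsStronglyAccessibleFunctor (D.inverseImage F).ι μ :=
    isStronglyAccessibleFunctor_ι _ hBμ (fun X hX A _ f ↦
      exists_factorization_of_isCardinalPresentable hκμ D hD F hF hι hX f)
  exact ⟨⟨h.target, h.source, h.preserves_colimits⟩, h⟩
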